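/- Let $\mathit{Var}$ be an infinite set of variables. For a signature $\Sigma$ (a set of function symbols with finite arities), let $\mathrm{Ter}^\infty(\Sigma)$ be the set of finite and infinite terms over $\Sigma$ and $\mathit{Var}$, with the metric $d_\infty(t,u)=2^{-n}$ for $t\neq u$, where $n$ is the least depth at which $t$ and $u$ differ (and $d_\infty(t,t)=0$). Equivalently, this is the metric completion of the finite terms under the term metric $\infty$, in which every function symbol is interpreted as $(x_1,\dots,x_n)\mapsto\frac12\max(x_1,\dots,x_n)$. An infinitary term rewriting system (iTRS) over term metric $\infty$ is a pair $(\Sigma,R)$ with $R\subseteq \mathrm{Ter}^\infty(\Sigma)\times \mathrm{Ter}^\infty(\Sigma)$ such that for every rule $(l,r)\in R$ the term $l$ is not a variable and every variable occurring in $r$ occurs in $l$ (neither finiteness nor linearity of the sides is required). It is *non-collapsing* if no right-hand side is a variable. We write $s\to_R t$ with redex position $p$ if $s=C[\theta(l)]_p$ and $t=C[\theta(r)]_p$ for some rule $(l,r)\in R$, substitution $\theta$, and context $C$ with hole at position $p$. An open reduction sequence of length $\alpha$ ($\alpha$ a nonzero limit ordinal) is a map $f:\alpha\to \mathrm{Ter}^\infty(\Sigma)$,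 continuous with respect to the order topology on $\alpha$ and the metric $d_\infty$, such that $f(\beta)\to_R f(\beta+1)$ for all $\beta<\alpha$. The iTRS is *strongly converging* if for every open reduction sequence $f$, of any length $\alpha$, and every position $p$ there is $\beta<\alpha$ such that no step $f(\gamma)\to_R f(\gamma+1)$ with $\beta\le\gamma<\alpha$ contracts a redex at position $p$. The *disjoint union* of two iTRSs has as signature the disjoint union of the two signatures and as rules the rules of both systems. **Theorem.** Over term metric $\infty$, the disjoint union of two strongly converging non-collapsing iTRSs is a strongly converging iTRS. (Left-linearity is not required.) -/

import Mathlib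

open Set

universe u u₁ u₂ v w

/-- A signature: a set of function symbols, each with a finite arity. -/
structure Signature where
  Sym : Type u
  arity : Sym → ℕ

/-- A position is a finite word of argument indices (counted from `0`). -/
abbrev Position : Type := List ℕ

/-- Possible labels of a node: a function symbol or a variable. -/
abbrev NodeLabel (S : Signature.{u}) (V : Type v) : Type (max u v) := S.Sym ⊕ V

/-- In a labelled tree, the node `q` has an `i`-th child exactly if `q` carries a function symbol
whose arity exceeds `i`. -/
def IsTreeLabelling {S : Signature.{u}} {V : Type v}
    (ℓ : Position → Option (NodeLabel S V)) : Prop :=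
  ∀ (q : Position) (i : ℕ),
    ℓ (q ++ [i]) ≠ none ↔ ∃ F : S.Sym, ℓ q = some (Sum.inl F) ∧ i < S.arity F

/-- Finite and infinite terms over the signature `S` with variables from `V`, as labelled trees:
`label p` is the symbol at position `p`, and is `none` if `p` is not a position of the term. -/
@[ext]
structure Term (S : Signature.{u}) (V : Type v) : Type (max u v) where
  label : Position → Option (NodeLabel S V)
  root_ne_none : label [] ≠ none
  isTree : IsTreeLabelling label

namespace Term

variable {S : Signature.{u}} {V : Type v}

/-- The set of positions of a term. -/
def positions (t : Term S V) : Set Position := {p | t.label p ≠ none}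

/-- The variable `x` occurs in the term `t`. -/
def Occurs (x : V) (t : Term S V) : Prop := ∃ p, t.label p = some (Sum.inr x)

/-- The term consisting of the variable `x`. -/
def var (x : V) : Term S V where
  label p := match p with
    | [] => some (Sum.inr x)
    | _ :: _ => none
  root_ne_none := by simp
  isTree := by
    intro q i
    cases q <;> simp

/-- The term `F(t₁, …, tₙ)`. -/
def app (F : S.Sym) (ts : Fin (S.arity F) → Term S V) : Term S V where
  label p := match p with
    | [] => some (Sum.inl F)
    | i :: q => if h : i < S.arity F then (ts ⟨i, h⟩).label q else none
  root_ne_none := by simp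
  isTree := by
    intro q i
    cases q with
    | nil =>
      by_cases h : i < S.arity F
      · simp [h, (ts ⟨i, h⟩).root_ne_none]
      · simp [h]
    | cons j q =>
      by_cases h : j < S.arity F
      · simpa [h] using (ts ⟨j, h⟩).isTree q i
      · simp [h]

open Classical in
/-- The term `t[u]_p`: the subterm of `t` at the position `p` is replaced by `u`. -/
noncomputable def replaceAt (t : Term S V) (p : Position) (hp : p ∈ t.positions)
    (u : Term S V) : Term S V where
  label q := if p <+: q then u.label (q.drop p.length) else t.label q
  root_ne_none := by
    by_cases h : p <+: []
    · simpa [h] using u.root_ne_none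
    · simpa [h] using t.root_ne_none
  isTree := by
    intro q i
    by_cases h : p <+: q
    · obtain ⟨r, rfl⟩ := h
      have h1 : p <+: p ++ r ++ [i] := ⟨r ++ [i], by simp⟩
      have h2 : (p ++ r ++ [i]).drop p.length = r ++ [i] := by simp
      have h3 : (p ++ r).drop p.length = r := by simp
      simp only [if_pos h1, if_pos (List.prefix_append p r), h2, h3]
      exact u.isTree r i
    · by_cases h' : p <+: q ++ [i]
      · have hpq : p = q ++ [i] := by
          rcases List.prefix_concat_iff.mp h' with h'' | h''
          · exact h''
          · exact absurd h'' h
        subst hpq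
        simp only [if_pos h', if_neg h]
        have := (t.isTree q i).mp hp
        simpa [u.root_ne_none] using this
      · simp only [if_neg h', if_neg h]
        exact t.isTree q i

/-- The labelling obtained from `ℓ` by grafting the term `θ x` at each node labelled with a
variable `x`. -/
def substLabel (θ : V → Term S V) :
    (Position → Option (NodeLabel S V)) → Position → Option (NodeLabel S V)
  | ℓ, [] => match ℓ [] with
    | some (Sum.inr x) => (θ x).label []
    | some (Sum.inl F) => some (Sum.inl F)
    | none => none
  | ℓ, i :: q => match ℓ [] with
    | some (Sum.inr x) => (θ x).label (i :: q)
    | some (Sum.inl _) => substLabel θ (fun r => ℓ (i :: r)) q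
    | none => none

theorem substLabel_var (θ : V → Term S V) (ℓ : Position → Option (NodeLabel S V)) {x : V}
    (h : ℓ [] = some (Sum.inr x)) (p : Position) : substLabel θ ℓ p = (θ x).label p := by
  cases p <;> simp [substLabel, h]

theorem substLabel_none (θ : V → Term S V) (ℓ : Position → Option (NodeLabel S V))
    (h : ℓ [] = none) (p : Position) : substLabel θ ℓ p = none := by
  cases p <;> simp [substLabel, h]

theorem isTree_substLabel (θ : V → Term S V) (q : Position) :
    ∀ (ℓ : Position → Option (NodeLabel S V)), IsTreeLabelling ℓ → ∀ i : ℕ,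
      (substLabel θ ℓ (q ++ [i]) ≠ none ↔
        ∃ F : S.Sym, substLabel θ ℓ q = some (Sum.inl F) ∧ i < S.arity F) := by
  induction q with
  | nil =>
    intro ℓ hℓ i
    rcases h : ℓ [] with _ | F | x
    · simp [substLabel, h]
    · have h1 := hℓ [] i
      rcases h2 : ℓ [i] with _ | G | y
      · simpa [substLabel, h, h2] using h1
      · simpa [substLabel, h, h2] using h1
      · simpa [substLabel, h, h2, (θ y).root_ne_none] using h1
    · rw [substLabel_var θ ℓ h, substLabel_var θ ℓ h]
      exact (θ x).isTree [] i
  | cons j q ih =>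
    intro ℓ hℓ i
    rcases h : ℓ [] with _ | F | x
    · simp [substLabel, h]
    · have := ih (fun r => ℓ (j :: r)) (fun r k => hℓ (j :: r) k) i
      simpa [substLabel, h] using this
    · rw [substLabel_var θ ℓ h, substLabel_var θ ℓ h]
      exact (θ x).isTree (j :: q) i

/-- The result of applying the substitution `θ` to the term `t`. -/
def subst (θ : V → Term S V) (t : Term S V) : Term S V where
  label := substLabel θ t.label
  root_ne_none := by
    rcases h : t.label [] with _ | F | x
    · exact absurd h t.root_ne_none
    · simp [substLabel, h]
    · simpa [substLabel, h] using (θ x).root_ne_none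
  isTree := fun q i => isTree_substLabel θ q t.label t.isTree i

/-! ### The metric of the term metric `∞` -/

/-- The least depth at which two terms differ. -/
noncomputable def diffDepth (t u : Term S V) : ℕ :=
  sInf {n | ∃ p : Position, p.length = n ∧ t.label p ≠ u.label p}

theorem le_diffDepth_iff {t u : Term S V} (h : t ≠ u) (n : ℕ) :
    n ≤ diffDepth t u ↔ ∀ p : Position, p.length < n → t.label p = u.label p := by
  have hne : {n | ∃ p : Position, p.length = n ∧ t.label p ≠ u.label p}.Nonempty := by
    by_contra hcon
    apply h
    ext1
    funext p
    by_contra hp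
    exact hcon ⟨p.length, p, rfl, hp⟩
  constructor
  · intro hn p hp
    by_contra hcon
    have : diffDepth t u ≤ p.length := Nat.sInf_le ⟨p, rfl, hcon⟩
    omega
  · intro hn
    obtain ⟨p, hp, hcon⟩ := Nat.sInf_mem hne
    by_contra hlt
    exact hcon (hn p (by rw [hp]; exact not_le.mp hlt))

theorem diffDepth_comm (t u : Term S V) : diffDepth t u = diffDepth u t := by
  simp only [diffDepth, ne_comm]

open Classical in
/-- The distance of two distinct terms is `2⁻ⁿ`, where `n` is the least depth at which they
differ. -/
noncomputable instance : Dist (Term S V) where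
  dist t u := if t = u then 0 else (1 / 2 : ℝ) ^ diffDepth t u

theorem dist_eq_of_ne {t u : Term S V} (h : t ≠ u) :
    dist t u = (1 / 2 : ℝ) ^ diffDepth t u := if_neg h

theorem dist_le_pow_iff (t u : Term S V) (n : ℕ) :
    dist t u ≤ (1 / 2 : ℝ) ^ n ↔ ∀ p : Position, p.length < n → t.label p = u.label p := by
  by_cases h : t = u
  · subst h
    have : dist t t = 0 := if_pos rfl
    simp [this]
  · rw [dist_eq_of_ne h, ← le_diffDepth_iff h]
    exact pow_le_pow_iff_right_of_lt_one₀ (by norm_num) (by norm_num)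

theorem dist_le_max (t u s : Term S V) : dist t s ≤ max (dist t u) (dist u s) := by
  by_cases h1 : t = u
  · subst h1; exact le_max_right _ _
  by_cases h2 : u = s
  · subst h2; exact le_max_left _ _
  have key : dist t s ≤ (1 / 2 : ℝ) ^ min (diffDepth t u) (diffDepth u s) := by
    rw [dist_le_pow_iff]
    intro p hp
    exact ((le_diffDepth_iff h1 _).mp le_rfl p (hp.trans_le (min_le_left _ _))).trans
      ((le_diffDepth_iff h2 _).mp le_rfl p (hp.trans_le (min_le_right _ _)))
  rcases le_total (diffDepth t u) (diffDepth u s) with h | h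
  · rw [min_eq_left h, ← dist_eq_of_ne h1] at key
    exact key.trans (le_max_left _ _)
  · rw [min_eq_right h, ← dist_eq_of_ne h2] at key
    exact key.trans (le_max_right _ _)

theorem dist_nonneg' (t u : Term S V) : 0 ≤ dist t u := by
  by_cases h : t = u
  · exact (if_pos h : dist t u = 0).ge
  · rw [dist_eq_of_ne h]; positivity

/-- Terms with the metric `d_∞`. -/
noncomputable instance : MetricSpace (Term S V) where
  dist_self t := if_pos rfl
  dist_comm t u := by
    by_cases h : t = u
    · subst h; rfl
    · rw [dist_eq_of_ne h, dist_eq_of_ne (Ne.symm h), diffDepth_comm]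
  dist_triangle t u s :=
    (dist_le_max t u s).trans (max_le_add_of_nonneg (dist_nonneg' _ _) (dist_nonneg' _ _))
  eq_of_dist_eq_zero := by
    intro t u h
    by_contra hne
    rw [dist_eq_of_ne hne] at h
    exact absurd h (by positivity)

/-! The following facts show that the terms defined above, with this metric, are the completion of
the space of finite terms with the distance function determined by the ultra-metric maps
`½ · max`. -/

theorem dist_le_one (t u : Term S V) : dist t u ≤ 1 := by
  have := (dist_le_pow_iff t u 0).mpr (by simp)
  simpa using this

theorem dist_of_root_ne {t u : Term S V} (h : t.label [] ≠ u.label []) : dist t u = 1 := by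
  have hne : t ≠ u := fun he => h (by rw [he])
  have h0 : diffDepth t u = 0 := Nat.le_zero.mp (Nat.sInf_le ⟨[], rfl, h⟩)
  rw [dist_eq_of_ne hne, h0, pow_zero]

theorem dist_app_le_iff (F : S.Sym) (ts us : Fin (S.arity F) → Term S V) (n : ℕ) :
    dist (app F ts) (app F us) ≤ (1 / 2 : ℝ) ^ (n + 1) ↔
      ∀ i, dist (ts i) (us i) ≤ (1 / 2 : ℝ) ^ n := by
  simp only [dist_le_pow_iff]
  constructor
  · intro h i p hp
    simpa [app] using h (i.1 :: p) (by simpa using hp)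
  · intro h p hp
    cases p with
    | nil => rfl
    | cons i p =>
      by_cases hi : i < S.arity F
      · simpa [app, hi] using h ⟨i, hi⟩ p (by simpa using hp)
      · simp [app, hi]

theorem dist_app (F : S.Sym) (ts us : Fin (S.arity F) → Term S V) :
    dist (app F ts) (app F us) = 1 / 2 * ⨆ i, dist (ts i) (us i) := by
  have hb : BddAbove (range fun i => dist (ts i) (us i)) := Set.finite_range _ |>.bddAbove
  apply le_antisymm
  · by_cases h : ts = us
    · subst h; simp
    have hex : ∃ i, ts i ≠ us i := Function.ne_iff.mp h
    obtain ⟨i₀, hi₀⟩ := hex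
    have : Nonempty (Fin (S.arity F)) := ⟨i₀⟩
    obtain ⟨j, hj⟩ := exists_eq_ciSup_of_finite (f := fun i => dist (ts i) (us i))
    have hj' : ∀ i, dist (ts i) (us i) ≤ dist (ts j) (us j) := fun i => by
      have := le_ciSup hb i
      rw [← hj] at this
      exact this
    have hne : ts j ≠ us j := by
      intro he
      have := hj' i₀
      rw [he, dist_self] at this
      exact hi₀ (dist_le_zero.mp this)
    rw [← hj]
    simp only [dist_eq_of_ne hne] at hj' ⊢
    rw [← pow_succ']
    exact (dist_app_le_iff F ts us _).mpr hj'
  · have hhalf : ∀ i, dist (ts i) (us i) ≤ 2 * dist (app F ts) (app F us) := by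
      intro i
      by_cases h : app F ts = app F us
      · have h1 : ∀ n, dist (ts i) (us i) ≤ (1 / 2 : ℝ) ^ n := fun n =>
          (dist_app_le_iff F ts us n).mp (by rw [h, dist_self]; positivity) i
        rw [h, dist_self, mul_zero]
        exact ge_of_tendsto' (tendsto_pow_atTop_nhds_zero_of_lt_one (by norm_num) (by norm_num)) h1
      · have hpos : 1 ≤ diffDepth (app F ts) (app F us) := by
          rw [le_diffDepth_iff h]
          intro p hp
          have : p = [] := List.length_eq_zero_iff.mp (by omega)
          subst this
          rfl
        obtain ⟨n, hn⟩ := Nat.exists_eq_add_of_le' hpos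
        have hd : dist (app F ts) (app F us) = (1 / 2 : ℝ) ^ (n + 1) := by
          rw [dist_eq_of_ne h, hn]
        have := (dist_app_le_iff F ts us n).mp hd.le i
        rw [hd, pow_succ']
        linarith
    have : ⨆ i, dist (ts i) (us i) ≤ 2 * dist (app F ts) (app F us) :=
      Real.iSup_le hhalf (mul_nonneg zero_le_two dist_nonneg)
    linarith

instance : CompleteSpace (Term S V) := by
  apply Metric.complete_of_cauchySeq_tendsto
  intro t ht
  have hN : ∀ n : ℕ, ∃ N, ∀ k ≥ N, ∀ p : Position, p.length < n →
      (t k).label p = (t N).label p := by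
    intro n
    obtain ⟨N, hN⟩ := Metric.cauchySeq_iff'.mp ht ((1 / 2 : ℝ) ^ n) (by positivity)
    exact ⟨N, fun k hk => (dist_le_pow_iff _ _ _).mp (hN k hk).le⟩
  choose N hN using hN
  have key : ∀ n k, N n ≤ k → ∀ p : Position, p.length < n →
      (t k).label p = (t (N (p.length + 1))).label p := by
    intro n k hk p hp
    have h1 := hN n (max k (N (p.length + 1))) (hk.trans (le_max_left _ _)) p hp
    have h2 := hN n k hk p hp
    have h3 := hN (p.length + 1) (max k (N (p.length + 1))) (le_max_right _ _) p (by omega)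
    rw [h2, ← h1, h3]
  refine ⟨⟨fun p => (t (N (p.length + 1))).label p, (t _).root_ne_none, ?_⟩, ?_⟩
  · intro q i
    have h1 := key (q.length + 2) _ le_rfl q (by omega)
    have h2 := key (q.length + 2) _ le_rfl (q ++ [i]) (by simp)
    have h3 := (t (N (q.length + 2))).isTree q i
    rw [h1, h2] at h3
    exact h3
  · rw [Metric.tendsto_atTop]
    intro ε hε
    obtain ⟨n, hn⟩ := exists_pow_lt_of_lt_one hε (by norm_num : (1 / 2 : ℝ) < 1)
    exact ⟨N n, fun k hk => lt_of_le_of_lt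
      ((dist_le_pow_iff _ _ _).mpr fun p hp => key n k hk p hp) hn⟩

theorem finite_positions_of_length (t : Term S V) (n : ℕ) :
    {p ∈ t.positions | p.length = n}.Finite := by
  classical
  induction n with
  | zero => exact (Set.finite_singleton []).subset fun p hp => List.length_eq_zero_iff.mp hp.2
  | succ n ih =>
    let ar : Position → ℕ := fun q =>
      match t.label q with
      | some (Sum.inl F) => S.arity F
      | _ => 0
    have : (⋃ q ∈ {p ∈ t.positions | p.length = n},
        (fun i : ℕ => q ++ [i]) '' Set.Iio (ar q)).Finite :=
      ih.biUnion fun q _ => (Set.finite_Iio _).image _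
    refine this.subset ?_
    rintro p ⟨hp, hlen⟩
    obtain rfl | ⟨q, i, rfl⟩ := List.eq_nil_or_concat p
    · simp at hlen
    · rw [List.concat_eq_append] at hp hlen ⊢
      obtain ⟨F, hF, hi⟩ := (t.isTree q i).mp hp
      simp only [Set.mem_iUnion]
      refine ⟨q, ⟨?_, by simpa using hlen⟩, i, ?_, rfl⟩
      · simp [positions, hF]
      · simpa [ar, hF] using hi

theorem dense_finite_terms [Nonempty V] : Dense {t : Term S V | t.positions.Finite} := by
  classical
  obtain ⟨x⟩ := ‹Nonempty V›
  rw [Metric.dense_iff]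
  intro t ε hε
  obtain ⟨n, hn⟩ := exists_pow_lt_of_lt_one hε (by norm_num : (1 / 2 : ℝ) < 1)
  let s : Term S V :=
    { label := fun p =>
        if p.length < n then t.label p
        else if p.length = n ∧ t.label p ≠ none then some (Sum.inr x) else none
      root_ne_none := by
        by_cases h : 0 < n
        · simpa [h] using t.root_ne_none
        · have : n = 0 := by omega
          subst this
          simp [t.root_ne_none]
      isTree := by
        intro q i
        have h := t.isTree q i
        by_cases h1 : q.length + 1 < n
        · have h2 : q.length < n := by omega
          simpa [h1, h2] using h
        · by_cases h2 : q.length < n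
          · have h3 : q.length + 1 = n := by omega
            have h4 : ¬ n < n := lt_irrefl n
            simpa [h2, h3] using h
          · have h3 : q.length + 1 ≠ n := by omega
            by_cases h4 : q.length = n ∧ t.label q ≠ none <;> simp [h1, h2, h3, h4] }
  refine ⟨s, ?_, ?_⟩
  · rw [Metric.mem_ball]
    refine lt_of_le_of_lt ((dist_le_pow_iff _ _ n).mpr fun p hp => ?_) hn
    simp [s, hp]
  · have hfin : (⋃ k ∈ Set.Iic n, {p ∈ t.positions | p.length = k}).Finite :=
      (Set.finite_Iic n).biUnion fun k _ => finite_positions_of_length t k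
    refine hfin.subset fun p hp => ?_
    have hp' : s.label p ≠ none := hp
    simp only [Set.mem_iUnion]
    by_cases h1 : p.length < n
    · exact ⟨p.length, h1.le, by simpa [s, h1, positions] using hp', rfl⟩
    · by_cases h2 : p.length = n ∧ t.label p ≠ none
      · exact ⟨p.length, h2.1.le, h2.2, rfl⟩
      · simp [s, h1, h2] at hp'

end Term

/-! ### Infinitary term rewriting -/

/-- An infinitary term rewriting system over the signature `S` and the term metric `∞`.
Both sides of a rule may be infinite, and left-hand sides need not be linear. -/
structure ITRS (S : Signature.{u}) (V : Type v) where
  rules : Set (Term S V × Term S V)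
  lhs_ne_var : ∀ l r, (l, r) ∈ rules → ∀ x : V, l ≠ Term.var x
  occurs_lhs : ∀ l r, (l, r) ∈ rules → ∀ x : V, r.Occurs x → l.Occurs x

namespace ITRS

variable {S : Signature.{u}} {V : Type v}

/-- No right-hand side is a variable. -/
def NonCollapsing (R : ITRS S V) : Prop :=
  ∀ l r, (l, r) ∈ R.rules → ∀ x : V, r ≠ Term.var x

/-- `s` rewrites to `t` by contracting a redex at the position `p`: `s = C[θ(l)]` and
`t = C[θ(r)]` for a rule `l → r`, a substitution `θ` and a context `C` with hole at `p`. -/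
def StepAt (R : ITRS S V) (p : Position) (s t : Term S V) : Prop :=
  ∃ l r, (l, r) ∈ R.rules ∧ ∃ (θ : V → Term S V) (c : Term S V) (hp : p ∈ c.positions),
    s = c.replaceAt p hp (l.subst θ) ∧ t = c.replaceAt p hp (r.subst θ)

/-- The single-step rewrite relation. -/
def Step (R : ITRS S V) (s t : Term S V) : Prop := ∃ p, R.StepAt p s t

/-- `f`, restricted to the ordinals below `α`, is a reduction sequence of length `α`: it is
continuous (for the order topology on ordinals and the metric `d_∞` on terms), and each term
rewrites to its successor. -/
def IsReductionSequence (R : ITRS S V) (α : Ordinal.{w}) (f : Ordinal.{w} → Term S V) : Prop :=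
  ContinuousOn f (Iio α) ∧ ∀ β, Order.succ β < α → R.Step (f β) (f (Order.succ β))

/-- In no open reduction sequence is a redex at one and the same position contracted arbitrarily
close to the end of the sequence. -/
def StronglyConverging (R : ITRS S V) : Prop :=
  ∀ (α : Ordinal.{w}), Order.IsSuccLimit α →
    ∀ f : Ordinal.{w} → Term S V, R.IsReductionSequence α f →
      ∀ p : Position, ∃ β < α, ∀ γ, β ≤ γ → γ < α → ¬ R.StepAt p (f γ) (f (Order.succ γ))

end ITRS

/-! ### Disjoint unions -/

/-- A signature morphism: a map of symbols that preserves arities. -/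
structure SigMorphism (S : Signature.{u}) (T : Signature.{v}) where
  toFun : S.Sym → T.Sym
  arity_eq : ∀ F, T.arity (toFun F) = S.arity F

/-- The translation of terms along a signature morphism. -/
def Term.translate {S : Signature.{u}} {T : Signature.{v}} {V : Type w} (σ : SigMorphism S T)
    (t : Term S V) : Term T V where
  label p := (t.label p).map (Sum.map σ.toFun id)
  root_ne_none := by simpa using t.root_ne_none
  isTree := by
    intro q i
    have h := t.isTree q i
    rcases hq : t.label q with _ | F | x <;> simp_all [σ.arity_eq]

/-- The disjoint union of two signatures. -/
def Signature.disjointUnion (S : Signature.{u}) (T : Signature.{v}) : Signature.{max u v} where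
  Sym := S.Sym ⊕ T.Sym
  arity := Sum.elim S.arity T.arity

/-- The left injection into a disjoint union of signatures. -/
def SigMorphism.inl (S : Signature.{u}) (T : Signature.{v}) :
    SigMorphism S (S.disjointUnion T) where
  toFun := Sum.inl
  arity_eq _ := rfl

/-- The right injection into a disjoint union of signatures. -/
def SigMorphism.inr (S : Signature.{u}) (T : Signature.{v}) :
    SigMorphism T (S.disjointUnion T) where
  toFun := Sum.inr
  arity_eq _ := rfl

theorem Term.translate_ne_var {S : Signature.{u}} {T : Signature.{v}} {V : Type w}
    (σ : SigMorphism S T) {t : Term S V} {x : V} (h : t ≠ Term.var x) :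
    t.translate σ ≠ Term.var x := by
  intro heq
  have hl : ∀ p, (t.translate σ).label p = (Term.var x : Term T V).label p := by simp [heq]
  apply h
  ext1
  funext p
  have hp := hl p
  cases p with
  | nil =>
    clear hl heq h
    rcases hq : t.label [] with _ | F | y <;> simp_all [Term.translate, Term.var]
  | cons i q => simpa [Term.translate, Term.var] using hp

theorem Term.occurs_translate {S : Signature.{u}} {T : Signature.{v}} {V : Type w}
    (σ : SigMorphism S T) {t : Term S V} {x : V} :
    (t.translate σ).Occurs x ↔ t.Occurs x := by
  simp [Term.Occurs, Term.translate]

/-- The disjoint union of two systems: the rules of both, translated to the disjoint union of the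
two signatures (in which every symbol again has the ultra-metric map `½ · max`). -/
def ITRS.disjointUnion {S : Signature.{u}} {T : Signature.{v}} {V : Type w}
    (R₁ : ITRS S V) (R₂ : ITRS T V) : ITRS (S.disjointUnion T) V where
  rules :=
    (fun e => (e.1.translate (SigMorphism.inl S T), e.2.translate (SigMorphism.inl S T))) ''
        R₁.rules ∪
      (fun e => (e.1.translate (SigMorphism.inr S T), e.2.translate (SigMorphism.inr S T))) ''
        R₂.rules
  lhs_ne_var := by
    rintro l r (⟨⟨l', r'⟩, h, he⟩ | ⟨⟨l', r'⟩, h, he⟩) x <;>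
      obtain ⟨rfl, rfl⟩ := Prod.mk.inj he
    · exact Term.translate_ne_var _ (R₁.lhs_ne_var l' r' h x)
    · exact Term.translate_ne_var _ (R₂.lhs_ne_var l' r' h x)
  occurs_lhs := by
    rintro l r (⟨⟨l', r'⟩, h, he⟩ | ⟨⟨l', r'⟩, h, he⟩) x <;>
      obtain ⟨rfl, rfl⟩ := Prod.mk.inj he
    · simpa [Term.occurs_translate] using R₁.occurs_lhs l' r' h x
    · simpa [Term.occurs_translate] using R₂.occurs_lhs l' r' h x

/-! Fix an open reduction sequence and treat positions by induction on prefixes. Suppose that from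
some point on no redex properly above `p` is contracted, and that redexes at `p` are nevertheless
contracted arbitrarily late. Choose one such step. The symbol at `p` then belongs to one of the two
signatures, and it does so at all later stages: steps elsewhere leave it alone, a contraction at `p`
must use a rule of that component and, the rule being non-collapsing, puts a symbol of the same
signature at `p`, and labels stabilize at limits (`exists_forall_not_stepAt`).

Now look at the subterms at `p` through `cap`, which replaces all maximal foreign subterms by one
and the same variable. Capping commutes with instantiating a native rule (`cap_subst_translate`),
even a non-linear or infinite one, because it acts on the substituted terms only. So each step
becomes either a step of the component or an identity (`cap_eq_or_step`). Foreign redexes stay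
foreign because the other system is non-collapsing too. Capping also preserves continuity, and a
step at `p` becomes a genuine step at the root.

The capped sequence is thus a reduction sequence with identity steps interspersed. Deleting these by
enumerating the remaining indices (`exists_of_weak`) gives an open reduction sequence of the
component with root steps arbitrarily close to its end, against strong convergence. -/

open Order Topology

namespace Term

/-! ### Grafting and subterms. -/

section Labels

variable {S : Signature.{u}} {V : Type v}

open Classical in
/-- The labelling obtained from `ℓ` by grafting `m` at the position `p`. -/
noncomputable def graftLabel (ℓ : Position → Option (NodeLabel S V)) (p : Position)
    (m : Position → Option (NodeLabel S V)) : Position → Option (NodeLabel S V) :=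
  fun q => if p <+: q then m (q.drop p.length) else ℓ q

theorem label_replaceAt (t : Term S V) (p : Position) (hp : p ∈ t.positions) (u : Term S V) :
    (t.replaceAt p hp u).label = graftLabel t.label p u.label := rfl

variable (ℓ m : Position → Option (NodeLabel S V))

@[simp]
theorem graftLabel_nil : graftLabel ℓ [] m = m := by
  funext q
  simp [graftLabel]

@[simp]
theorem graftLabel_cons_nil (i : ℕ) (p : Position) : graftLabel ℓ (i :: p) m [] = ℓ [] := by
  simp [graftLabel]

@[simp]
theorem graftLabel_cons_cons_same (i : ℕ) (p q : Position) :
    graftLabel ℓ (i :: p) m (i :: q) = graftLabel (fun r => ℓ (i :: r)) p m q := by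
  simp [graftLabel]

theorem graftLabel_cons_cons_of_ne {i j : ℕ} (h : i ≠ j) (p q : Position) :
    graftLabel ℓ (i :: p) m (j :: q) = ℓ (j :: q) := by
  simp [graftLabel, h]

theorem graftLabel_append (p q r : Position) :
    graftLabel ℓ (p ++ q) m (p ++ r) = graftLabel (fun s => ℓ (p ++ s)) q m r := by
  induction p generalizing ℓ with
  | nil => rfl
  | cons i p ih => simpa using ih fun s => ℓ (i :: s)

theorem graftLabel_of_not_prefix {p q : Position} (h : ¬ p <+: q) :
    graftLabel ℓ p m q = ℓ q := if_neg h

theorem graftLabel_self (p : Position) : graftLabel ℓ p m p = m [] := by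
  simp [graftLabel]

end Labels

section Subterm

variable {S : Signature.{u}} {V : Type v}

/-- The subterm of `t` at the position `p`. -/
def subtermAt (t : Term S V) (p : Position) (hp : p ∈ t.positions) : Term S V where
  label q := t.label (p ++ q)
  root_ne_none := by simpa [positions] using hp
  isTree := by
    intro q i
    simpa using t.isTree (p ++ q) i

theorem subtermAt_replaceAt_append (c u : Term S V) (p q : Position)
    (hpq : p ++ q ∈ c.positions) (hp : p ∈ c.positions) (hq : q ∈ (c.subtermAt p hp).positions)
    (hp' : p ∈ (c.replaceAt (p ++ q) hpq u).positions) :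
    (c.replaceAt (p ++ q) hpq u).subtermAt p hp' = (c.subtermAt p hp).replaceAt q hq u := by
  ext1
  funext r
  exact graftLabel_append _ _ _ _ _

theorem mem_positions_of_append {t : Term S V} {p q : Position} (h : p ++ q ∈ t.positions) :
    p ∈ t.positions := by
  induction q using List.reverseRecOn with
  | nil => simpa using h
  | append_singleton q i ih =>
    rw [← List.append_assoc] at h
    obtain ⟨F, hF, -⟩ := (t.isTree (p ++ q) i).mp h
    exact ih (by simp [positions, hF])

end Subterm

end Term

/-! ### The native top layer of a term. -/

/-- A partial map of symbols that preserves arities where it is defined. -/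
structure SigProjection (T : Signature.{u}) (S : Signature.{v}) where
  toFun : T.Sym → Option S.Sym
  arity_eq : ∀ G F, toFun G = some F → S.arity F = T.arity G

namespace Term

variable {T : Signature.{u}} {S : Signature.{u₁}} {V : Type v} (π : SigProjection T S) (x : V)

/-- The labelling obtained by projecting symbols along `π`, where each maximal subterm whose root
symbol lies outside the domain of `π` is replaced by the variable `x`. -/
def capLabel : (Position → Option (NodeLabel T V)) → Position → Option (NodeLabel S V)
  | ℓ, [] => match ℓ [] with
    | some (Sum.inr y) => some (Sum.inr y)
    | some (Sum.inl G) => match π.toFun G with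
      | some F => some (Sum.inl F)
      | none => some (Sum.inr x)
    | none => none
  | ℓ, i :: q => match ℓ [] with
    | some (Sum.inr _) => none
    | some (Sum.inl G) => match π.toFun G with
      | some _ => capLabel (fun r => ℓ (i :: r)) q
      | none => none
    | none => none

theorem isTree_capLabel (q : Position) :
    ∀ (ℓ : Position → Option (NodeLabel T V)), IsTreeLabelling ℓ → ∀ i : ℕ,
      (capLabel π x ℓ (q ++ [i]) ≠ none ↔
        ∃ F : S.Sym, capLabel π x ℓ q = some (Sum.inl F) ∧ i < S.arity F) := by
  induction q with
  | nil =>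
    intro ℓ hℓ i
    rcases h : ℓ [] with _ | G | y
    · simp [capLabel, h]
    · rcases hG : π.toFun G with _ | F
      · simp [capLabel, h, hG]
      · have h1 := hℓ [] i
        rw [h] at h1
        have h2 : capLabel π x ℓ [i] ≠ none ↔ ℓ [i] ≠ none := by
          rcases h3 : ℓ [i] with _ | H | y
          · simp [capLabel, h, hG, h3]
          · rcases hH : π.toFun H <;> simp [capLabel, h, hG, h3, hH]
          · simp [capLabel, h, hG, h3]
        simp only [List.nil_append] at h1 ⊢
        rw [h2, h1]
        simp [capLabel, h, hG, π.arity_eq G F hG]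
    · simp [capLabel, h]
  | cons j q ih =>
    intro ℓ hℓ i
    rcases h : ℓ [] with _ | G | y
    · simp [capLabel, h]
    · rcases hG : π.toFun G with _ | F
      · simp [capLabel, h, hG]
      · simpa [capLabel, h, hG] using
          ih (fun r => ℓ (j :: r)) (fun r k => hℓ (j :: r) k) i
    · simp [capLabel, h]

/-- The top layer of a term: symbols are projected along `π`, and each maximal subterm whose root
symbol lies outside the domain of `π` is replaced by the variable `x`. -/
def cap (t : Term T V) : Term S V where
  label := capLabel π x t.label
  root_ne_none := by
    rcases h : t.label [] with _ | G | y
    · exact absurd h t.root_ne_none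
    · rcases hG : π.toFun G <;> simp [capLabel, h, hG]
    · simp [capLabel, h]
  isTree q i := isTree_capLabel π x q t.label t.isTree i

/-- The cap at `p` reads only the labels at prefixes of `p`. This is what makes capping
non-expansive, so that continuity survives it. -/
theorem capLabel_congr {ℓ m : Position → Option (NodeLabel T V)} {n : ℕ}
    (h : ∀ p : Position, p.length < n → ℓ p = m p) (p : Position) (hp : p.length < n) :
    capLabel π x ℓ p = capLabel π x m p := by
  induction p generalizing ℓ m n with
  | nil => simp [capLabel, h [] hp]
  | cons i p ih =>
    obtain ⟨n, rfl⟩ : ∃ k, n = k + 1 := ⟨n - 1, by simp at hp; omega⟩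
    have h0 := h [] (by simp)
    have := ih (ℓ := fun r => ℓ (i :: r)) (m := fun r => m (i :: r)) (n := n)
      (fun p hp => h (i :: p) (by simpa using hp)) (by simpa using hp)
    simp only [capLabel, h0, this]

theorem cap_of_foreign {t : Term T V} {G : T.Sym} (h : t.label [] = some (Sum.inl G))
    (hG : π.toFun G = none) : t.cap π x = var x := by
  ext1
  funext p
  cases p <;> simp [cap, capLabel, h, hG, var]

/-- All proper ancestors of a node of the cap are native, so the recursion reaches `p` and sees the
graft. The node `p` itself may be the root of a foreign subterm. -/
theorem capLabel_graftLabel {ℓ m : Position → Option (NodeLabel T V)} {p : Position}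
    (hp : capLabel π x ℓ p ≠ none) :
    capLabel π x (graftLabel ℓ p m) = graftLabel (capLabel π x ℓ) p (capLabel π x m) := by
  induction p generalizing ℓ with
  | nil => simp
  | cons i p ih =>
    rcases h : ℓ [] with _ | G | y
    · simp [capLabel, h] at hp
    · rcases hG : π.toFun G with _ | F
      · simp [capLabel, h, hG] at hp
      · funext q
        cases q with
        | nil => simp [capLabel]
        | cons j q =>
          by_cases hij : i = j
          · subst hij
            simp only [capLabel, h, hG] at hp
            simpa [capLabel, h, hG] using congrFun (ih hp) q
          · rw [graftLabel_cons_cons_of_ne _ _ hij]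
            simp [capLabel, graftLabel_cons_cons_of_ne _ _ hij]
    · simp [capLabel, h] at hp

/-- For a term, such a `p` lies strictly inside a maximal foreign subterm, whose root survives the
replacement and hides the change. -/
theorem capLabel_graftLabel_of_eq_none {ℓ m : Position → Option (NodeLabel T V)} {p : Position}
    (hp : capLabel π x ℓ p = none) (hℓ : ℓ p ≠ none) :
    capLabel π x (graftLabel ℓ p m) = capLabel π x ℓ := by
  induction p generalizing ℓ with
  | nil =>
    rcases h : ℓ [] with _ | G | y
    · exact absurd h hℓ
    · rcases hG : π.toFun G <;> simp [capLabel, h, hG] at hp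
    · simp [capLabel, h] at hp
  | cons i p ih =>
    funext q
    cases q with
    | nil => simp [capLabel]
    | cons j q =>
      by_cases hij : i = j
      · subst hij
        rcases h : ℓ [] with _ | G | y
        · simp [capLabel, h]
        · rcases hG : π.toFun G with _ | F
          · simp [capLabel, h, hG]
          · simp only [capLabel, h, hG] at hp
            simpa [capLabel, h, hG] using congrFun (ih hp hℓ) q
        · simp [capLabel, h]
      · simp [capLabel, graftLabel_cons_cons_of_ne _ _ hij]

/-- All function symbols of the translated term are native, so the cap passes through it and acts
only on the substituted terms. Equal terms have equal caps, hence repeated variables do no harm. -/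
theorem cap_subst_translate (σ : SigMorphism S T) (hσ : ∀ F, π.toFun (σ.toFun F) = some F)
    (θ : V → Term T V) (l : Term S V) :
    ((l.translate σ).subst θ).cap π x = l.subst fun y => (θ y).cap π x := by
  ext1
  funext q
  change capLabel π x (substLabel θ fun p => (l.label p).map (Sum.map σ.toFun id)) q =
    substLabel (fun y => (θ y).cap π x) l.label q
  generalize l.label = ℓ
  induction q generalizing ℓ with
  | nil =>
    rcases h : ℓ [] with _ | F | y
    · simp [capLabel, substLabel, h]
    · simp [capLabel, substLabel, h, hσ]
    · simp [capLabel, substLabel, h, cap]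
  | cons i q ih =>
    rcases h : ℓ [] with _ | F | y
    · simp [capLabel, substLabel, h]
    · simpa [capLabel, substLabel, h, hσ] using ih fun r => ℓ (i :: r)
    · rw [substLabel_var _ ℓ h]
      have : (substLabel θ fun p => (ℓ p).map (Sum.map σ.toFun id)) = (θ y).label :=
        funext fun p => substLabel_var θ _ (by simp [h]) p
      rw [this]
      rfl

theorem label_nil_subst {l : Term T V} (θ : V → Term T V) {G : T.Sym}
    (h : l.label [] = some (Sum.inl G)) : (l.subst θ).label [] = some (Sum.inl G) := by
  simp [subst, substLabel, h]

theorem label_nil_translate (σ : SigMorphism S T) {t : Term S V} {F : S.Sym}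
    (h : t.label [] = some (Sum.inl F)) :
    (t.translate σ).label [] = some (Sum.inl (σ.toFun F)) := by
  simp only [translate, h]
  rfl

theorem eq_var_of_label_nil {t : Term S V} {y : V} (h : t.label [] = some (Sum.inr y)) :
    t = var y := by
  have hnone : ∀ i (q : Position), t.label (i :: q) = none := by
    intro i q
    by_contra hq
    have h1 : [i] ∈ t.positions := mem_positions_of_append (q := q) hq
    obtain ⟨F, hF, -⟩ := (t.isTree [] i).mp h1
    simp [h] at hF
  ext1
  funext p
  cases p <;> simp [var, h, hnone]

theorem exists_symbol_of_ne_var {t : Term S V} (h : ∀ y, t ≠ var y) :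
    ∃ F, t.label [] = some (Sum.inl F) := by
  rcases ht : t.label [] with _ | F | y
  · exact absurd ht t.root_ne_none
  · exact ⟨F, rfl⟩
  · exact absurd (eq_var_of_label_nil ht) (h y)

end Term

/-! ### Continuity as stabilization of labels. -/

section Continuity

variable {S : Signature.{u}} {V : Type v}

/-- Along `f`, the labels at bounded depth stabilize to those of `f β` below the limit `β`. -/
def Term.LimitAt (f : Ordinal.{w} → Term S V) (β : Ordinal.{w}) : Prop :=
  ∀ n : ℕ, ∃ a < β, ∀ c, a < c → c < β → ∀ p : Position, p.length < n →
    (f c).label p = (f β).label p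

/-- Zero and successors are isolated in the order topology, so only limit points impose a condition.
There the intervals `Ioc a β` form a neighbourhood basis, and distance at most `2⁻ⁿ` means agreement
at depths below `n`. -/
theorem Term.continuousOn_Iio_iff {α : Ordinal.{w}} {f : Ordinal.{w} → Term S V} :
    ContinuousOn f (Iio α) ↔ ∀ β < α, IsSuccLimit β → Term.LimitAt f β := by
  have hlim : ∀ β, IsSuccLimit β → (ContinuousAt f β ↔ Term.LimitAt f β) := by
    intro β hβ
    have hb : β ≠ 0 := hβ.ne_bot
    have hbasis := (SuccOrder.hasBasis_nhds_Ioc_of_exists_lt (a := β) ⟨0, pos_iff_ne_zero.mpr hb⟩)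
    constructor
    · intro hf n
      have := Metric.tendsto_nhds.mp hf ((1 / 2 : ℝ) ^ n) (by positivity)
      obtain ⟨a, ha, hac⟩ := hbasis.mem_iff.mp this
      exact ⟨a, ha, fun c h1 h2 => (Term.dist_le_pow_iff _ _ n).mp (le_of_lt (hac ⟨h1, h2.le⟩))⟩
    · intro hf
      refine Metric.tendsto_nhds.mpr fun ε hε => ?_
      obtain ⟨n, hn⟩ := exists_pow_lt_of_lt_one hε (by norm_num : (1 / 2 : ℝ) < 1)
      obtain ⟨a, ha, hac⟩ := hf n
      refine hbasis.mem_iff.mpr ⟨a, ha, fun c hc => lt_of_le_of_lt ?_ hn⟩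
      refine (Term.dist_le_pow_iff _ _ n).mpr ?_
      rcases hc.2.lt_or_eq with h | h
      · exact hac c hc.1 h
      · intro p _
        rw [h]
  rw [isOpen_Iio.continuousOn_iff]
  constructor
  · intro h β hβ hl
    exact (hlim β hl).mp (h hβ)
  · intro h β hβ
    by_cases hl : IsSuccLimit β
    · exact (hlim β hl).mpr (h β hβ hl)
    · have := SuccOrder.nhds_eq_pure.mpr hl
      rw [ContinuousAt, this]
      exact tendsto_pure_nhds f β

end Continuity

/-! ### Deleting identity steps. -/

section Reindexing

variable {S : Signature.{u}} {V : Type v}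

/-- Transfinite induction on `b`. At a limit, each label of `h b` is already attained at an earlier
stage, to which the induction hypothesis applies. -/
theorem Term.eq_of_forall_succ_eq {h : Ordinal.{w} → Term S V} {a b : Ordinal.{w}} (hab : a ≤ b)
    (hlim : ∀ β, a < β → β ≤ b → IsSuccLimit β → Term.LimitAt h β)
    (hstep : ∀ γ, a ≤ γ → γ < b → h γ = h (succ γ)) : h b = h a := by
  induction b using Ordinal.limitRecOn with
  | zero => rw [nonpos_iff_eq_zero.mp hab]
  | add_one b ih =>
    rw [← Order.succ_eq_add_one] at hab hlim hstep ⊢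
    rcases hab.lt_or_eq with hlt | rfl
    · have hab' := lt_succ_iff.mp hlt
      rw [← hstep b hab' (lt_succ b)]
      exact ih hab' (fun β h1 h2 => hlim β h1 (h2.trans (le_succ b)))
        (fun γ h1 h2 => hstep γ h1 (h2.trans (lt_succ b)))
    · rfl
  | limit b hb ih =>
    rcases hab.lt_or_eq with hlt | rfl
    · ext1
      funext p
      obtain ⟨c, hc, hcb⟩ := hlim b hlt le_rfl hb (p.length + 1)
      have hd : max a c < b := max_lt hlt hc
      have had : a ≤ succ (max a c) := (le_max_left a c).trans (le_succ _)
      have hdb := hb.succ_lt hd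
      rw [← hcb _ ((le_max_right a c).trans_lt (lt_succ _)) hdb p (Nat.lt_succ_self _),
        ih _ hdb had (fun β h1 h2 => hlim β h1 (h2.trans hdb.le))
          (fun γ h1 h2 => hstep γ h1 (h2.trans hdb))]
    · rfl

/-- In a strongly converging system, sequences that may also contain identity steps do not contract
redexes at a fixed position arbitrarily close to their end. -/
theorem ITRS.StronglyConverging.exists_of_weak {R : ITRS S V}
    (hR : ITRS.StronglyConverging.{u, v, w} R) {α β₀ : Ordinal.{w}} (hα : IsSuccLimit α)
    {h : Ordinal.{w} → Term S V}
    (hlim : ∀ β, β₀ < β → β < α → IsSuccLimit β → Term.LimitAt h β)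
    (hstep : ∀ γ, β₀ ≤ γ → γ < α → h γ = h (succ γ) ∨ R.Step (h γ) (h (succ γ)))
    (hβ₀ : β₀ < α) (p : Position) :
    ∃ β < α, ∀ γ, β ≤ γ → γ < α → ¬ R.StepAt p (h γ) (h (succ γ)) := by
  by_contra! hcon
  -- The indices of genuine steps, where a term rewriting to itself counts as genuine. Adding `Ici
  -- α` makes the set unbounded, so that `enumOrd` is strictly increasing; the index `δ` of `α`
  -- becomes the length of the new sequence.
  let A : Set Ordinal.{w} := {γ | β₀ ≤ γ ∧ γ < α ∧ R.Step (h γ) (h (succ γ))} ∪ Ici α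
  have hA : ¬ BddAbove A := by
    rintro ⟨b, hb⟩
    have : succ (max α b) ≤ b := hb (Or.inr ((le_max_left α b).trans (le_succ _)))
    exact absurd ((lt_succ (max α b)).trans_le this) (not_lt.mpr (le_max_right α b))
  let e := Ordinal.enumOrd A
  have he : StrictMono e := Ordinal.enumOrd_strictMono hA
  have hmem : ∀ ξ, e ξ ∈ A := Ordinal.enumOrd_mem hA
  have hsurj : ∀ {γ}, γ ∈ A → ∃ ξ, e ξ = γ := fun hγ => Ordinal.enumOrd_surjective hA hγ
  obtain ⟨δ, hδ⟩ := hsurj (γ := α) (Or.inr self_mem_Ici)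
  have hlt : ∀ {ξ}, ξ < δ ↔ e ξ < α := fun {ξ} => by rw [← hδ, he.lt_iff_lt]
  have hge : ∀ ξ, β₀ ≤ e ξ := fun ξ => (hmem ξ).elim (fun h => h.1) (fun h => hβ₀.le.trans h)
  have hcof : ∀ β < α, ∃ ξ, β ≤ e ξ ∧ e ξ < α ∧ R.StepAt p (h (e ξ)) (h (succ (e ξ))) := by
    intro β hβ
    obtain ⟨γ, h1, h2, h3⟩ := hcon (max β₀ β) (max_lt hβ₀ hβ)
    obtain ⟨ξ, rfl⟩ := hsurj (γ := γ) (Or.inl ⟨(le_max_left _ _).trans h1, h2, p, h3⟩)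
    exact ⟨ξ, (le_max_right _ _).trans h1, h2, h3⟩
  have hconst : ∀ a b, β₀ ≤ a → a ≤ b → b < α → (∀ γ, a ≤ γ → γ < b → γ ∉ A) → h b = h a :=
    fun a b h1 h2 h3 h4 => Term.eq_of_forall_succ_eq h2
      (fun β h5 h6 => hlim β (h1.trans_lt h5) (h6.trans_lt h3))
      fun γ h5 h6 => (hstep γ (h1.trans h5) (h6.trans h3)).resolve_right
        fun h7 => h4 γ h5 h6 (Or.inl ⟨h1.trans h5, h6.trans h3, h7⟩)
  -- Here the assumption for contradiction enters: contractions at `p` are cofinal in `α`, so there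
  -- is no last genuine step.
  have hsuccδ : ∀ ξ < δ, succ ξ < δ := by
    intro ξ hξ
    obtain ⟨η, h1, h2, -⟩ := hcof _ (hα.succ_lt (hlt.mp hξ))
    have h3 : ξ < η := he.lt_iff_lt.mp ((lt_succ _).trans_le h1)
    exact (succ_le_of_lt h3).trans_lt (hlt.mpr h2)
  have hsucc : ∀ ξ < δ, h (e (succ ξ)) = h (succ (e ξ)) := by
    intro ξ hξ
    -- No index of `A` lies from `succ (e ξ)` up to `e (succ ξ)`, so the terms are constant there.
    refine hconst _ _ ((hge ξ).trans (le_succ _)) (succ_le_of_lt (he (lt_succ ξ)))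
      (hlt.mp (hsuccδ ξ hξ)) fun γ h1 h2 h3 => ?_
    exact absurd (Ordinal.enumOrd_succ_le hA h3 (succ_le_iff.mp h1)) (not_le.mpr h2)
  have hδlim : IsSuccLimit δ := by
    obtain ⟨η, -, h2, -⟩ := hcof β₀ hβ₀
    exact ⟨fun hmin => absurd (hlt.mpr h2) hmin.not_lt,
      isSuccPrelimit_of_succ_lt hsuccδ⟩
  have hseq : R.IsReductionSequence δ (fun ξ => h (e ξ)) := by
    refine ⟨Term.continuousOn_Iio_iff.mpr fun ξ hξ hξl n => ?_, fun ξ hξ => ?_⟩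
    · let s := sInf {s | ∀ η < ξ, e η ≤ s}
      have hsξ : s ≤ e ξ := csInf_le' fun η hη => (he hη).le
      have hs : ∀ η < ξ, e η < s := fun η hη => (he (lt_succ η)).trans_le
        (csInf_mem (s := {s | ∀ η < ξ, e η ≤ s}) ⟨e ξ, fun η hη => (he hη).le⟩ _
          (hξl.succ_lt hη))
      have hex : ∀ a < s, ∃ η < ξ, a < e η := by
        intro a ha
        have := notMem_of_lt_csInf' ha
        simpa using this
      have hξ0 : (0 : Ordinal) < ξ := hξl.bot_lt
      have hs0 : β₀ < s := (hge 0).trans_lt (hs 0 hξ0)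
      have hsl : IsSuccLimit s := by
        refine ⟨fun hmin => absurd hs0 hmin.not_lt, isSuccPrelimit_of_succ_lt fun a ha => ?_⟩
        obtain ⟨η, hη, h1⟩ := hex a ha
        exact (succ_le_of_lt h1).trans_lt (hs η hη)
      have heq : h (e ξ) = h s := by
        refine hconst s _ hs0.le hsξ (hlt.mp hξ) fun γ h1 h2 h3 => ?_
        obtain ⟨η, rfl⟩ := hsurj h3
        exact absurd (hs η (he.lt_iff_lt.mp h2)) (not_lt.mpr h1)
      obtain ⟨a, ha, hac⟩ := hlim s hs0 (hsξ.trans_lt (hlt.mp hξ)) hsl n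
      obtain ⟨η, hη, h1⟩ := hex a ha
      refine ⟨η, hη, fun c h2 h3 => ?_⟩
      rw [heq]
      exact hac _ (h1.trans (he h2)) (hs c h3)
    · have hξ' : ξ < δ := (lt_succ ξ).trans hξ
      have := (hmem ξ).resolve_right (not_le.mpr (hlt.mp hξ'))
      dsimp only
      rw [hsucc ξ hξ']
      exact this.2.2
  obtain ⟨β, hβ, hβ'⟩ := hR δ hδlim _ hseq p
  obtain ⟨ξ, h1, h2, h3⟩ := hcof (e β) (hlt.mp hβ)
  refine hβ' ξ (he.le_iff_le.mp h1) (hlt.mpr h2) ?_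
  rwa [hsucc ξ (hlt.mpr h2)]

end Reindexing

/-! ### Steps seen from one component. -/

namespace Term

variable {T : Signature.{u}} {S : Signature.{u₁}} {V : Type v}

/-- The node of `t` at the position `p` carries a symbol in the domain of `π`. -/
def NativeAt (π : SigProjection T S) (t : Term T V) (p : Position) : Prop :=
  ∃ G F, t.label p = some (Sum.inl G) ∧ π.toFun G = some F

theorem NativeAt.mem_positions {π : SigProjection T S} {t : Term T V} {p : Position}
    (h : t.NativeAt π p) : p ∈ t.positions := by
  obtain ⟨G, F, hG, -⟩ := h
  simp [positions, hG]

theorem replaceAt_nil (c u : Term T V) (h : [] ∈ c.positions) : c.replaceAt [] h u = u := by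
  ext1
  rw [label_replaceAt, graftLabel_nil]

end Term

namespace ITRS

variable {T : Signature.{u}} {S : Signature.{u₁}} {V : Type v}

/-- Each rule of `R` is either the translation of a rule of `R₁`, or both its sides have root
symbols that do not come from the signature of `R₁`. -/
structure IsComponent (R₁ : ITRS S V) (R : ITRS T V) (σ : SigMorphism S T)
    (π : SigProjection T S) : Prop where
  proj_map : ∀ F, π.toFun (σ.toFun F) = some F
  native_or_foreign : ∀ l r, (l, r) ∈ R.rules →
    (∃ l' r', (l', r') ∈ R₁.rules ∧ l = l'.translate σ ∧ r = r'.translate σ) ∨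
    ((∃ G, l.label [] = some (Sum.inl G) ∧ π.toFun G = none) ∧
      ∃ G, r.label [] = some (Sum.inl G) ∧ π.toFun G = none)

theorem StepAt.subtermAt {R : ITRS T V} {p q : Position} {s t : Term T V}
    (h : R.StepAt (p ++ q) s t) (hs : p ∈ s.positions) (ht : p ∈ t.positions) :
    R.StepAt q (s.subtermAt p hs) (t.subtermAt p ht) := by
  obtain ⟨l, r, hlr, θ, c, hc, rfl, rfl⟩ := h
  have hp := Term.mem_positions_of_append hc
  exact ⟨l, r, hlr, θ, c.subtermAt p hp, hc,
    Term.subtermAt_replaceAt_append c _ p q hc hp hc hs,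
    Term.subtermAt_replaceAt_append c _ p q hc hp hc ht⟩

theorem StepAt.label_eq {R : ITRS T V} {p q : Position} {s t : Term T V}
    (h : R.StepAt q s t) (hqp : ¬ q <+: p) : s.label p = t.label p := by
  obtain ⟨l, r, hlr, θ, c, hc, rfl, rfl⟩ := h
  simp only [Term.label_replaceAt, Term.graftLabel_of_not_prefix _ _ hqp]

theorem StepAt.subtermAt_eq {R : ITRS T V} {p q : Position} {s t : Term T V}
    (h : R.StepAt q s t) (hqp : ¬ q <+: p) (hpq : ¬ p <+: q)
    (hs : p ∈ s.positions) (ht : p ∈ t.positions) : s.subtermAt p hs = t.subtermAt p ht := by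
  ext1
  funext r
  refine h.label_eq fun hpre => ?_
  exact (List.prefix_or_prefix_of_prefix hpre (List.prefix_append p r)).elim hqp hpq

namespace IsComponent

variable {R₁ : ITRS S V} {R : ITRS T V} {σ : SigMorphism S T} {π : SigProjection T S}

/-- A foreign rule cannot match at a native root, so the rule is native and the step is not lost as
an identity under capping. -/
theorem stepAt_nil_cap (hc : R₁.IsComponent R σ π) (x : V) {s t : Term T V}
    (h : R.StepAt [] s t) (hs : s.NativeAt π []) :
    R₁.StepAt [] (s.cap π x) (t.cap π x) := by
  obtain ⟨l, r, hlr, θ, c, hp, rfl, rfl⟩ := h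
  rw [Term.replaceAt_nil] at hs ⊢
  rw [Term.replaceAt_nil]
  rcases hc.native_or_foreign l r hlr with ⟨l', r', hlr', rfl, rfl⟩ | ⟨⟨G, hG, hGπ⟩, -⟩
  · have hnil : [] ∈ (c.cap π x).positions := (c.cap π x).root_ne_none
    refine ⟨l', r', hlr', fun y => (θ y).cap π x, c.cap π x, hnil, ?_, ?_⟩ <;>
      rw [Term.replaceAt_nil, Term.cap_subst_translate π x σ hc.proj_map]
  · obtain ⟨G', F, hG', hF⟩ := hs
    rw [Term.label_nil_subst θ hG] at hG'
    simp_all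

/-- Strictly inside a foreign subterm a step is invisible. At a node of the cap, a native rule acts
on the cap, while a foreign rule has foreign roots on both sides, so redex and contractum both
collapse to `x`. -/
theorem cap_eq_or_step (hc : R₁.IsComponent R σ π) (x : V) {s t : Term T V}
    (h : R.Step s t) : s.cap π x = t.cap π x ∨ R₁.Step (s.cap π x) (t.cap π x) := by
  obtain ⟨q, l, r, hlr, θ, c, hp, rfl, rfl⟩ := h
  by_cases hq : Term.capLabel π x c.label q = none
  · left
    ext1
    change Term.capLabel π x (Term.graftLabel _ _ _) = Term.capLabel π x (Term.graftLabel _ _ _)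
    rw [Term.capLabel_graftLabel_of_eq_none π x hq hp,
      Term.capLabel_graftLabel_of_eq_none π x hq hp]
  · have key : ∀ u, (c.replaceAt q hp u).cap π x = (c.cap π x).replaceAt q hq (u.cap π x) :=
      fun u => Term.ext (Term.capLabel_graftLabel π x hq)
    rw [key, key]
    rcases hc.native_or_foreign l r hlr with
      ⟨l', r', hlr', rfl, rfl⟩ | ⟨⟨G, hG, hGπ⟩, ⟨H, hH, hHπ⟩⟩
    · right
      refine ⟨q, l', r', hlr', fun y => (θ y).cap π x, c.cap π x, hq, ?_, ?_⟩ <;>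
        rw [Term.cap_subst_translate π x σ hc.proj_map]
    · left
      rw [Term.cap_of_foreign π x (Term.label_nil_subst θ hG) hGπ,
        Term.cap_of_foreign π x (Term.label_nil_subst θ hH) hHπ]

/-- Only a step at `p` itself can affect the label there; its rule must be native, and its
right-hand side, not being a variable, has a native root symbol. -/
theorem nativeAt_of_stepAt (hc : R₁.IsComponent R σ π) (hn : R₁.NonCollapsing)
    {s t : Term T V} {p q : Position} (h : R.StepAt q s t) (hqp : q <+: p → q = p)
    (hs : s.NativeAt π p) : t.NativeAt π p := by
  by_cases hpre : q <+: p
  · obtain rfl := hqp hpre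
    obtain ⟨l, r, hlr, θ, c, hp, rfl, rfl⟩ := h
    simp only [Term.NativeAt, Term.label_replaceAt, Term.graftLabel_self] at hs ⊢
    rcases hc.native_or_foreign l r hlr with ⟨l', r', hlr', rfl, rfl⟩ | ⟨⟨G, hG, hGπ⟩, -⟩
    · obtain ⟨F, hF⟩ := Term.exists_symbol_of_ne_var (hn l' r' hlr')
      exact ⟨σ.toFun F, F, Term.label_nil_subst θ (Term.label_nil_translate σ hF), hc.proj_map F⟩
    · obtain ⟨G', F, hG', hF⟩ := hs
      rw [Term.label_nil_subst θ hG] at hG'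
      simp_all
  · rwa [Term.NativeAt, ← h.label_eq hpre]

/-- If eventually no step contracts a redex properly above `p`, and the symbol at `p` comes from a
strongly converging component, then eventually no step contracts a redex at `p`. -/
theorem exists_forall_not_stepAt [Nonempty V] (hc : R₁.IsComponent R σ π)
    (hn : R₁.NonCollapsing) (hR₁ : ITRS.StronglyConverging.{u₁, v, w} R₁) {α γ₀ : Ordinal.{w}}
    (hα : IsSuccLimit α) {f : Ordinal.{w} → Term T V} (hf : R.IsReductionSequence α f)
    (p : Position) (hγ₀ : γ₀ < α)
    (habove : ∀ γ, γ₀ ≤ γ → γ < α → ∀ q, q <+: p → q ≠ p → ¬ R.StepAt q (f γ) (f (succ γ)))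
    (hnat : (f γ₀).NativeAt π p) :
    ∃ β < α, ∀ γ, β ≤ γ → γ < α → ¬ R.StepAt p (f γ) (f (succ γ)) := by
  classical
  obtain ⟨x⟩ := ‹Nonempty V›
  have hlim := Term.continuousOn_Iio_iff.mp hf.1
  have hpre : ∀ γ, γ₀ ≤ γ → γ < α → ∀ q, R.StepAt q (f γ) (f (succ γ)) → q <+: p → q = p :=
    fun γ h1 h2 q hq hqp => by_contra fun hne => habove γ h1 h2 q hqp hne hq
  have hnative : ∀ γ, γ₀ ≤ γ → γ < α → (f γ).NativeAt π p := by
    intro γ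
    induction γ using Ordinal.limitRecOn with
    | zero =>
      intro h1 _
      rwa [← nonpos_iff_eq_zero.mp h1]
    | add_one γ ih =>
      rw [← Order.succ_eq_add_one]
      intro h1 h2
      rcases h1.lt_or_eq with h3 | rfl
      · have h4 := lt_succ_iff.mp h3
        have h5 := (lt_succ γ).trans h2
        obtain ⟨q, hq⟩ := hf.2 γ h2
        exact hc.nativeAt_of_stepAt hn hq (hpre γ h4 h5 q hq) (ih h4 h5)
      · exact hnat
    | limit γ hγ ih =>
      intro h1 h2
      rcases h1.lt_or_eq with h3 | rfl
      · obtain ⟨a, ha, hac⟩ := hlim γ h2 hγ (p.length + 1)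
        have h4 : max a γ₀ < γ := max_lt ha h3
        have h5 := hγ.succ_lt h4
        have := ih _ h5 ((le_max_right a γ₀).trans (le_succ _)) (h5.trans h2)
        rwa [Term.NativeAt,
          hac _ ((le_max_left a γ₀).trans_lt (lt_succ _)) h5 p (Nat.lt_succ_self _)] at this
      · exact hnat
  -- The default value is never used from `γ₀` on, where `p` is always a position.
  let h : Ordinal.{w} → Term S V := fun γ =>
    if hp : p ∈ (f γ).positions then ((f γ).subtermAt p hp).cap π x else Term.var x
  have hh : ∀ γ (hp : p ∈ (f γ).positions), h γ = ((f γ).subtermAt p hp).cap π x :=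
    fun γ hp => dif_pos hp
  have hpos : ∀ γ, γ₀ ≤ γ → γ < α → p ∈ (f γ).positions :=
    fun γ h1 h2 => (hnative γ h1 h2).mem_positions
  have hsucc : ∀ γ, γ₀ ≤ γ → γ < α → p ∈ (f (succ γ)).positions :=
    fun γ h1 h2 => hpos _ (h1.trans (le_succ γ)) (hα.succ_lt h2)
  obtain ⟨β, hβ, hβ'⟩ := hR₁.exists_of_weak (h := h) (β₀ := γ₀) hα
    (fun β h1 h2 h3 n => by
      obtain ⟨a, ha, hac⟩ := hlim β h2 h3 (p.length + n)
      refine ⟨max a γ₀, max_lt ha h1, fun c h4 h5 q hq => ?_⟩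
      have hc0 := (le_max_right a γ₀).trans_lt h4
      rw [hh c (hpos c hc0.le (h5.trans h2)), hh β (hpos β h1.le h2)]
      refine Term.capLabel_congr π x (n := n) (fun r hr => ?_) q hq
      exact hac c ((le_max_left a γ₀).trans_lt h4) h5 (p ++ r) (by simpa using hr))
    (fun γ h1 h2 => by
      rw [hh γ (hpos γ h1 h2), hh _ (hsucc γ h1 h2)]
      obtain ⟨q, hq⟩ := hf.2 γ (hα.succ_lt h2)
      -- A redex at or below `p` gives a step of the subterm. Since redexes properly above `p` are
      -- excluded, any other redex is parallel to `p` and leaves the subterm unchanged.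
      by_cases hpq : p <+: q
      · obtain ⟨q', rfl⟩ := hpq
        exact hc.cap_eq_or_step x ⟨q', hq.subtermAt _ _⟩
      · left
        rw [hq.subtermAt_eq (fun hqp => hpq (hpre γ h1 h2 q hq hqp ▸ List.prefix_rfl)) hpq])
    hγ₀ []
  refine ⟨max β γ₀, max_lt hβ hγ₀, fun γ h1 h2 h3 => ?_⟩
  have h4 := (le_max_right β γ₀).trans h1
  refine hβ' γ ((le_max_left β γ₀).trans h1) h2 ?_
  rw [hh γ (hpos γ h4 h2), hh _ (hsucc γ h4 h2)]
  refine hc.stepAt_nil_cap x (StepAt.subtermAt (by simpa using h3) _ _) ?_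
  simpa [Term.NativeAt, Term.subtermAt] using hnative γ h4 h2

end IsComponent

end ITRS

/-! ### The two components of a disjoint union. -/

section DisjointUnion

variable {S₁ : Signature.{u₁}} {S₂ : Signature.{u₂}} {V : Type v}

/-- The projection of a disjoint union of signatures to its left part. -/
def SigProjection.left (S₁ : Signature.{u₁}) (S₂ : Signature.{u₂}) :
    SigProjection (S₁.disjointUnion S₂) S₁ where
  toFun := Sum.elim some fun _ => none
  arity_eq := by
    rintro (G | G) F h
    · obtain rfl := Option.some.inj h
      rfl
    · cases h

/-- The projection of a disjoint union of signatures to its right part. -/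
def SigProjection.right (S₁ : Signature.{u₁}) (S₂ : Signature.{u₂}) :
    SigProjection (S₁.disjointUnion S₂) S₂ where
  toFun := Sum.elim (fun _ => none) some
  arity_eq := by
    rintro (G | G) F h
    · cases h
    · obtain rfl := Option.some.inj h
      rfl

/-- Non-collapse of the other system ensures that the right-hand sides of its rules also have a
foreign root symbol. -/
theorem ITRS.isComponent_left (R₁ : ITRS S₁ V) (R₂ : ITRS S₂ V) (hn₂ : R₂.NonCollapsing) :
    R₁.IsComponent (R₁.disjointUnion R₂) (SigMorphism.inl S₁ S₂) (SigProjection.left S₁ S₂) where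
  proj_map _ := rfl
  native_or_foreign := by
    rintro l r (⟨⟨l', r'⟩, h, he⟩ | ⟨⟨l', r'⟩, h, he⟩) <;>
      obtain ⟨rfl, rfl⟩ := Prod.mk.inj he
    · exact Or.inl ⟨l', r', h, rfl, rfl⟩
    · obtain ⟨F, hF⟩ := Term.exists_symbol_of_ne_var (R₂.lhs_ne_var l' r' h)
      obtain ⟨G, hG⟩ := Term.exists_symbol_of_ne_var (hn₂ l' r' h)
      exact Or.inr ⟨⟨Sum.inr F, Term.label_nil_translate _ hF, rfl⟩,
        ⟨Sum.inr G, Term.label_nil_translate _ hG, rfl⟩⟩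

theorem ITRS.isComponent_right (R₁ : ITRS S₁ V) (R₂ : ITRS S₂ V) (hn₁ : R₁.NonCollapsing) :
    R₂.IsComponent (R₁.disjointUnion R₂) (SigMorphism.inr S₁ S₂) (SigProjection.right S₁ S₂) where
  proj_map _ := rfl
  native_or_foreign := by
    rintro l r (⟨⟨l', r'⟩, h, he⟩ | ⟨⟨l', r'⟩, h, he⟩) <;>
      obtain ⟨rfl, rfl⟩ := Prod.mk.inj he
    · obtain ⟨F, hF⟩ := Term.exists_symbol_of_ne_var (R₁.lhs_ne_var l' r' h)
      obtain ⟨G, hG⟩ := Term.exists_symbol_of_ne_var (hn₁ l' r' h)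
      exact Or.inr ⟨⟨Sum.inl F, Term.label_nil_translate _ hF, rfl⟩,
        ⟨Sum.inl G, Term.label_nil_translate _ hG, rfl⟩⟩
    · exact Or.inl ⟨l', r', h, rfl, rfl⟩

theorem ITRS.StepAt.exists_symbol {S : Signature.{u}} {R : ITRS S V} {p : Position}
    {s t : Term S V} (h : R.StepAt p s t) : ∃ F, s.label p = some (Sum.inl F) := by
  obtain ⟨l, r, hlr, θ, c, hp, rfl, rfl⟩ := h
  obtain ⟨F, hF⟩ := Term.exists_symbol_of_ne_var (R.lhs_ne_var l r hlr)
  exact ⟨F, by rw [Term.label_replaceAt, Term.graftLabel_self, Term.label_nil_subst θ hF]⟩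

end DisjointUnion

/-! ### Induction over positions. -/

theorem mainTheorem3 {S₁ : Signature.{u₁}} {S₂ : Signature.{u₂}} {V : Type v} [Infinite V]
    (R₁ : ITRS S₁ V) (R₂ : ITRS S₂ V)
    (hn₁ : R₁.NonCollapsing) (hn₂ : R₂.NonCollapsing)
    (h₁ : ITRS.StronglyConverging.{u₁, v, w} R₁)
    (h₂ : ITRS.StronglyConverging.{u₂, v, w} R₂) :
    ITRS.StronglyConverging.{max u₁ u₂, v, w} (R₁.disjointUnion R₂) := by
  intro α hα f hf
  have key : ∀ p : Position, ∀ β₀ < α,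
      (∀ γ, β₀ ≤ γ → γ < α → ∀ q, q <+: p → q ≠ p →
        ¬ (R₁.disjointUnion R₂).StepAt q (f γ) (f (succ γ))) →
      ∃ β < α, ∀ γ, β ≤ γ → γ < α → ¬ (R₁.disjointUnion R₂).StepAt p (f γ) (f (succ γ)) := by
    intro p β₀ hβ₀ habove
    -- The negation supplies a step at `p` after `β₀`. Its redex has a function symbol at `p`, which
    -- selects the component to project to.
    by_contra! hcon
    obtain ⟨γ₀, h3, h4, h5⟩ := hcon β₀ hβ₀
    have habove' : ∀ γ, γ₀ ≤ γ → γ < α → ∀ q, q <+: p → q ≠ p →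
        ¬ (R₁.disjointUnion R₂).StepAt q (f γ) (f (succ γ)) :=
      fun γ h6 h7 => habove γ (h3.trans h6) h7
    have hex : ∃ β < α, ∀ γ, β ≤ γ → γ < α →
        ¬ (R₁.disjointUnion R₂).StepAt p (f γ) (f (succ γ)) := by
      obtain ⟨F | F, hF⟩ := h5.exists_symbol
      · exact (R₁.isComponent_left R₂ hn₂).exists_forall_not_stepAt hn₁ h₁ hα hf p h4 habove'
          ⟨_, F, hF, rfl⟩
      · exact (R₁.isComponent_right R₂ hn₁).exists_forall_not_stepAt hn₂ h₂ hα hf p h4 habove'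
          ⟨_, F, hF, rfl⟩
    obtain ⟨β, hβ, hβ'⟩ := hex
    obtain ⟨γ, h6, h7, h8⟩ := hcon β hβ
    exact hβ' γ h6 h7 h8
  -- Strengthened to all prefixes of `p`, so that the induction hypothesis is exactly the absence of
  -- steps above the extended position.
  have hall : ∀ p : Position, ∃ β < α, ∀ γ, β ≤ γ → γ < α → ∀ q, q <+: p →
      ¬ (R₁.disjointUnion R₂).StepAt q (f γ) (f (succ γ)) := by
    intro p
    induction p using List.reverseRecOn with
    | nil =>
      obtain ⟨β, hβ, hβ'⟩ := key [] 0 hα.bot_lt fun γ _ _ q hq hne =>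
        absurd (List.prefix_nil.mp hq) hne
      refine ⟨β, hβ, fun γ h3 h4 q hq => ?_⟩
      rw [List.prefix_nil.mp hq]
      exact hβ' γ h3 h4
    | append_singleton p i ih =>
      obtain ⟨β₀, hβ₀, hβ₀'⟩ := ih
      obtain ⟨β, hβ, hβ'⟩ := key (p ++ [i]) β₀ hβ₀ fun γ h3 h4 q hq hne =>
        hβ₀' γ h3 h4 q ((List.prefix_concat_iff.mp hq).resolve_left hne)
      refine ⟨max β₀ β, max_lt hβ₀ hβ, fun γ h3 h4 q hq => ?_⟩
      rcases List.prefix_concat_iff.mp hq with rfl | hq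
      · exact hβ' γ ((le_max_right _ _).trans h3) h4
      · exact hβ₀' γ ((le_max_left _ _).trans h3) h4 q hq
  intro p
  obtain ⟨β, hβ, hβ'⟩ := hall p
  exact ⟨β, hβ, fun γ h3 h4 => hβ' γ h3 h4 p List.prefix_rfl⟩
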